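/- For a finite group $G$ let $d(G)=\frac{1}{|G|^2}\,|\{(x,y)\in G\times G : xy=yx\}|$ be its commuting probability, let $Z(G)$ denote its center and $G'$ its commutator subgroup. Call $G$ supersolvable if it has a series $1=H_0\le H_1\le\dots\le H_n=G$ of normal subgroups of $G$ with every factor $H_{i+1}/H_i$ cyclic. Call two groups $G$ and $H$ isoclinic if there are isomorphisms $\varphi:G/Z(G)\to H/Z(H)$ and $\phi:G'\to H'$ such that $\phi([g_1,g_2])=[h_1,h_2]$ whenever $\varphi(g_1Z(G))=h_1Z(H)$ and $\varphi(g_2Z(G))=h_2Z(H)$. Theorem 1.1. Let $G$ be a finite group. If $d(G)>5/16$, then (i) $G$ is supersolvable, or (ii) $G$ is isoclinic to the alternating group $A_4$, or (iii) $G/Z(G)$ is isoclinic to $A_4$. -/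

import Mathlib

open scoped commutatorElement


/-- A group `G` is supersolvable if it has a finite series
`1 = H 0 ≤ H 1 ≤ ⋯ ≤ H n = G` of subgroups, each normal in the whole group `G`, such that every
factor `H (i + 1) / H i` is cyclic. (The terms of `H` of index larger than `n` play no role; they
may be taken to be `G`.) -/
def IsSupersolvable (G : Type*) [Group G] : Prop :=
  ∃ (n : ℕ) (H : ℕ → Subgroup G) (_ : ∀ i, (H i).Normal),
    H 0 = ⊥ ∧ H n = ⊤ ∧
      ∀ i < n, H i ≤ H (i + 1) ∧ IsCyclic (H (i + 1) ⧸ (H i).subgroupOf (H (i + 1)))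

theorem commutatorElement_mem_commutator_self {G : Type*} [Group G] (g₁ g₂ : G) :
    ⁅g₁, g₂⁆ ∈ commutator G :=
  Subgroup.commutator_mem_commutator (Subgroup.mem_top g₁) (Subgroup.mem_top g₂)

/-- Two groups `G` and `H` are isoclinic if there are isomorphisms `φ : G / Z(G) ≃ H / Z(H)` and
`ψ : G' ≃ H'` such that `ψ [g₁, g₂] = [h₁, h₂]` whenever `φ (g₁ Z(G)) = h₁ Z(H)` and
`φ (g₂ Z(G)) = h₂ Z(H)`. -/
def Isoclinic (G H : Type*) [Group G] [Group H] : Prop :=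
  ∃ (φ : G ⧸ Subgroup.center G ≃* H ⧸ Subgroup.center H) (ψ : commutator G ≃* commutator H),
    ∀ (g₁ g₂ : G) (h₁ h₂ : H),
      φ (QuotientGroup.mk g₁) = QuotientGroup.mk h₁ →
      φ (QuotientGroup.mk g₂) = QuotientGroup.mk h₂ →
      ψ ⟨⁅g₁, g₂⁆, commutatorElement_mem_commutator_self g₁ g₂⟩ =
        ⟨⁅h₁, h₂⁆, commutatorElement_mem_commutator_self h₁ h₂⟩

/-!
The degrees `dᵢ` of the irreducible complex representations of `G` satisfy `∑ dᵢ² = |G|`; there are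
as many of them as conjugacy classes, and at most `[G : G']` of them equal `1`. This gives
`d(G) ≤ 1/4 + 3/(4|G'|)`, so that `d(G) > 5/16` forces `|G'| ≤ 11`.

Suppose that `G` is not supersolvable, and let `V` be a minimal normal subgroup of `G` inside `G'`.

If `V` is not cyclic, then `|V|` is `4`, `8` or `9` (orders `6` and `10` are excluded by the normal
Sylow subgroup of index two), `G'` is a `p`-group, and hence `V` is central in `G'`. As `V`
centralizes `G'`, every `C_V(x)` is normal in `G`, so an element `x` that does not centralize `V`
has no nontrivial fixed point on `V`. It follows that `C_G(V)` has index at least three, since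
otherwise every element outside `C_G(V)` would invert `V`, and every subgroup of `V` would be normal
in `G`. Counting commuting pairs then gives `d(G) ≤ 5/16` if `|V| ≥ 6`
(`IsMinimalNormal.commProb_le`). So `|V| = 4`, and `|G'|` is `4` or `8`.

If `|G'| = 4` and some `x` has no nontrivial fixed point on `G'`, then the centralizer of `x` has
index four and meets `G'` trivially, and the action of `G` on its cosets is a surjection `G → A₄`
whose kernel meets `G'` trivially (`hasA4Quotient_of_disjoint_centralizer`). Such a surjection makes
`G` isoclinic to `A₄` (`isoclinic_of_disjoint_ker_commutator`). If `|G'| = 8`, then `C_{G'}(x)` is a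
normal subgroup `M` of order two, and the previous case applies to `G / M`. As `M` is central, this
makes `G / Z(G)` isoclinic to `A₄`.

If `V` is cyclic, then `G / V` is not supersolvable and its derived subgroup has order at most five.
This leaves only `|V| = 2` and a derived subgroup of `G / V` that has order four and is minimal
normal, and again `G / Z(G)` is isoclinic to `A₄`.
-/

/-! ### A bound for the number of conjugacy classes -/

open MonoidAlgebra in
/-- The number of conjugacy classes is at most the number of simple factors of `ℂ[G]`: class
functions embed into the centre of `ℂ[G]`, and a central element of a product of matrix algebras is
determined by one diagonal entry in each factor. -/
theorem card_conjClasses_le_of_algEquiv {G : Type*} [Group G] [Finite G] {n : ℕ} {d : Fin n → ℕ}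
    [∀ i, NeZero (d i)]
    (e : MonoidAlgebra ℂ G ≃ₐ[ℂ] Π i, Matrix (Fin (d i)) (Fin (d i)) ℂ) :
    Nat.card (ConjClasses G) ≤ n := by
  classical
  have := Fintype.ofFinite G
  have := Fintype.ofFinite (ConjClasses G)
  let c : (ConjClasses G → ℂ) →ₗ[ℂ] MonoidAlgebra ℂ G :=
    { toFun := fun f ↦ ∑ g, single g (f (ConjClasses.mk g))
      map_add' := fun f f' ↦ by simp [single_add, Finset.sum_add_distrib]
      map_smul' := fun a f ↦ by simp [Finset.smul_sum] }
  have hc_apply (f : ConjClasses G → ℂ) (g : G) : (c f).coeff g = f (ConjClasses.mk g) := by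
    simp [c, coeff_sum, Finsupp.single_apply, Finsupp.finsetSum_apply]
  have hc_inj : Function.Injective c := by
    intro f f' h
    ext k
    obtain ⟨g, rfl⟩ := ConjClasses.mk_surjective k
    rw [← hc_apply f, ← hc_apply f', h]
  have hc_central (f : ConjClasses G → ℂ) (a : MonoidAlgebra ℂ G) : Commute a (c f) := by
    induction a using MonoidAlgebra.induction_on with
    | of h =>
      refine MonoidAlgebra.ext (Finsupp.ext fun g ↦ ?_)
      simp only [of_apply, coeff_single_mul_apply, coeff_mul_single_apply, hc_apply, one_mul, mul_one]
      congr 1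
      rw [ConjClasses.mk_eq_mk_iff_isConj, isConj_iff]
      exact ⟨h, by group⟩
    | add a b ha hb => exact ha.add_left hb
    | smul r a ha => exact ha.smul_left r
  -- A central matrix is scalar, so the entry at `(0, 0)` of each block determines it.
  let t : (ConjClasses G → ℂ) →ₗ[ℂ] (Fin n → ℂ) :=
    { toFun := fun f i ↦ e (c f) i 0 0
      map_add' := fun f f' ↦ by ext; simp
      map_smul' := fun a f ↦ by ext; simp }
  have ht : Function.Injective t := by
    rw [← LinearMap.ker_eq_bot, LinearMap.ker_eq_bot']
    intro f hf
    apply hc_inj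
    rw [map_zero, ← e.map_eq_zero_iff]
    refine funext fun i ↦ ?_
    change e (c f) i = 0
    have hcomm : ∀ B, Commute B (e (c f) i) := by
      intro B
      have := (hc_central f (e.symm (Pi.single i B))).map e
      rw [AlgEquiv.apply_symm_apply] at this
      have h2 := congrFun this.eq i
      simpa [Commute, SemiconjBy] using h2
    obtain ⟨r, hr⟩ := Matrix.mem_range_scalar_iff_commute_single'.2
      (fun a b ↦ hcomm (Matrix.single a b 1))
    have h0 : e (c f) i 0 0 = 0 := congrFun hf i
    rw [← hr] at h0 ⊢
    have : r = 0 := by simpa using h0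
    simp [this]
  have := LinearMap.finrank_le_finrank_of_injective ht
  simpa [Nat.card_eq_fintype_card] using this

/-- The number of one-dimensional simple factors of `ℂ[G]` is at most `[G : G']`: their product
is a commutative quotient of `ℂ[G]`, so it is spanned by the images of the elements of the
abelianization. -/
theorem card_filter_eq_one_le_of_algEquiv {G : Type*} [Group G] [Finite G] {n : ℕ}
    {d : Fin n → ℕ} [∀ i, NeZero (d i)]
    (e : MonoidAlgebra ℂ G ≃ₐ[ℂ] Π i, Matrix (Fin (d i)) (Fin (d i)) ℂ) :
    (Finset.univ.filter fun i ↦ d i = 1).card ≤ (commutator G).index := by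
  classical
  let I := {i : Fin n // d i = 1}
  have hu (i : I) (a b : Fin (d i.1)) : a = b := by
    have := i.2
    apply Fin.ext
    omega
  let ev : MonoidAlgebra ℂ G →ₐ[ℂ] (I → ℂ) :=
    AlgHom.ofLinearMap
      { toFun := fun a i ↦ e a i.1 0 0
        map_add' := fun a b ↦ by ext; simp
        map_smul' := fun r a ↦ by ext; simp }
      (by ext; simp)
      (by
        intro a b
        ext i
        have : Unique (Fin (d i.1)) := ⟨⟨0⟩, fun _ ↦ hu i _ _⟩
        simp only [LinearMap.coe_mk, AddHom.coe_mk, map_mul, Pi.mul_apply, Matrix.mul_apply]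
        rw [Fintype.sum_eq_single 0 (fun x hx ↦ absurd (hu i x 0) hx)])
  have hev : Function.Surjective ev := by
    intro f
    refine ⟨e.symm fun i ↦ if h : d i = 1 then Matrix.of fun _ _ ↦ f ⟨i, h⟩ else 0, ?_⟩
    ext i
    simp [ev, i.2]
  let φ : G →* (I → ℂ)ˣ := ((ev : MonoidAlgebra ℂ G →* (I → ℂ)).comp
    (MonoidAlgebra.of ℂ G)).toHomUnits
  have hφ (g : G) : ((φ g : (I → ℂ)ˣ) : I → ℂ) = ev (MonoidAlgebra.of ℂ G g) := rfl
  have hspan : Submodule.span ℂ (Set.range fun g : Abelianization G ↦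
      ((Abelianization.lift φ g : (I → ℂ)ˣ) : I → ℂ)) = ⊤ := by
    rw [eq_top_iff]
    intro f _
    obtain ⟨a, rfl⟩ := hev f
    induction a using MonoidAlgebra.induction_on with
    | of g => exact Submodule.subset_span ⟨Abelianization.of g, by simp [hφ]⟩
    | add a b ha hb => rw [map_add]; exact Submodule.add_mem _ (ha trivial) (hb trivial)
    | smul r a ha => rw [map_smul]; exact Submodule.smul_mem _ _ (ha trivial)
  have : Finite (Abelianization G) := inferInstanceAs (Finite (G ⧸ commutator G))
  have := Fintype.ofFinite (Abelianization G)
  have h := finrank_range_le_card (R := ℂ) (fun g : Abelianization G ↦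
      ((Abelianization.lift φ g : (I → ℂ)ˣ) : I → ℂ))
  rw [Set.finrank, hspan, finrank_top, Module.finrank_fintype_fun_eq_card,
    Fintype.card_subtype, ← Nat.card_eq_fintype_card (α := Abelianization G)] at h
  exact h

/-- The sum of squares formula `|G| = ∑ dᵢ²`, with `dᵢ² ≥ 4` unless `dᵢ = 1`. -/
theorem four_mul_card_conjClasses_le (G : Type*) [Group G] [Finite G] :
    4 * Nat.card (ConjClasses G) ≤ Nat.card G + 3 * (commutator G).index := by
  classical
  have := Fintype.ofFinite G
  have : NeZero (Nat.card G : ℂ) := ⟨Nat.cast_ne_zero.2 Nat.card_pos.ne'⟩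
  obtain ⟨n, d, hd, ⟨e⟩⟩ :=
    IsSemisimpleRing.exists_algEquiv_pi_matrix_of_isAlgClosed ℂ (MonoidAlgebra ℂ G)
  have h1 := card_conjClasses_le_of_algEquiv e
  have h2 := card_filter_eq_one_le_of_algEquiv e
  have h3 : Nat.card G = ∑ i, d i * d i := by
    have := e.toLinearEquiv.finrank_eq
    rw [Module.finrank_pi_fintype, (MonoidAlgebra.coeffLinearEquiv ℂ).finrank_eq] at this
    simpa [Module.finrank_matrix, Nat.card_eq_fintype_card] using this
  have h4 : 4 * n ≤ ∑ i, (d i * d i + 3 * if d i = 1 then 1 else 0) := by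
    have : ∀ i ∈ (Finset.univ : Finset (Fin n)),
        4 ≤ d i * d i + 3 * if d i = 1 then 1 else 0 := by
      intro i _
      have := (hd i).ne
      split_ifs with h
      · simp [h]
      · have : 2 ≤ d i := by omega
        nlinarith
    simpa [mul_comm] using Finset.card_nsmul_le_sum _ _ _ this
  rw [Finset.sum_add_distrib, ← h3, ← Finset.mul_sum, ← Finset.card_filter] at h4
  omega

theorem commProb_le_of_card_commutator (G : Type*) [Group G] [Finite G] :
    commProb G ≤ 1 / 4 + 3 / (4 * Nat.card (commutator G)) := by
  have h := four_mul_card_conjClasses_le G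
  have hi := (commutator G).card_mul_index
  have hG : (0 : ℚ) < Nat.card G := Nat.cast_pos.2 Nat.card_pos
  have hc : (0 : ℚ) < Nat.card (commutator G) := Nat.cast_pos.2 Nat.card_pos
  have h' : (4 : ℚ) * Nat.card (ConjClasses G) ≤ Nat.card G + 3 * (commutator G).index := by
    exact_mod_cast h
  have hi' : (Nat.card (commutator G) : ℚ) * (commutator G).index = Nat.card G := by
    exact_mod_cast hi
  rw [commProb_def', div_le_iff₀ hG]
  have : 3 / (4 * (Nat.card (commutator G) : ℚ)) * Nat.card G = 3 / 4 * (commutator G).index := by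
    rw [← hi']; field_simp
  rw [add_mul, this]
  linarith

theorem card_commutator_le_of_lt_commProb {G : Type*} [Group G] [Finite G]
    (hG : (5 / 16 : ℚ) < commProb G) : Nat.card (commutator G) ≤ 11 := by
  by_contra! h
  have h1 := commProb_le_of_card_commutator G
  have h2 : (12 : ℚ) ≤ Nat.card (commutator G) := by exact_mod_cast h
  have h3 : 3 / (4 * (Nat.card (commutator G) : ℚ)) ≤ 3 / (4 * 12) := by gcongr
  linarith

/-! ### Supersolvable groups -/

theorem IsSupersolvable.of_quotient {G : Type*} [Group G] (N : Subgroup G) [N.Normal]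
    (hN : IsCyclic N) (h : IsSupersolvable (G ⧸ N)) : IsSupersolvable G := by
  obtain ⟨n, H, hH, h0, hn, hs⟩ := h
  -- The series of `G / N` is pulled back to `G` and shifted by one, to make room for `⊥ ≤ N`.
  obtain ⟨K, hK0, hKs⟩ : ∃ K : ℕ → Subgroup G, K 0 = ⊥ ∧
      ∀ j, K (j + 1) = (H j).comap (QuotientGroup.mk' N) :=
    ⟨fun i ↦ i.casesOn ⊥ fun j ↦ (H j).comap (QuotientGroup.mk' N), rfl, fun _ ↦ rfl⟩
  have hK : ∀ i, (K i).Normal := by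
    rintro (_ | j)
    · rw [hK0]
      infer_instance
    · rw [hKs]
      exact (hH j).comap _
  refine ⟨n + 1, K, hK, hK0, by simp [hKs, hn], ?_⟩
  rintro (_ | j) hj
  · refine ⟨by simp [hK0], ?_⟩
    have h1 : K 1 = N := by simp [hKs, h0]
    rw [← h1] at hN
    exact isCyclic_of_surjective _ (QuotientGroup.mk'_surjective _)
  · obtain ⟨hle, hcyc⟩ := hs j (by omega)
    refine ⟨by rw [hKs, hKs]; exact Subgroup.comap_mono hle, ?_⟩
    let f : K (j + 2) →* H (j + 1) :=
      ((QuotientGroup.mk' N).comp (K (j + 2)).subtype).codRestrict _ fun x ↦ (hKs (j + 1)).le x.2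
    have hf : (K (j + 1)).subgroupOf (K (j + 2)) = ((H j).subgroupOf (H (j + 1))).comap f := by
      ext x
      rw [Subgroup.mem_subgroupOf, hKs j]
      rfl
    exact isCyclic_of_injective (QuotientGroup.map _ _ f hf.le) (by
      rw [← MonoidHom.ker_eq_bot_iff, QuotientGroup.ker_map, ← hf]
      simp)

theorem isSupersolvable_of_subsingleton (G : Type*) [Group G] [Subsingleton G] :
    IsSupersolvable G :=
  ⟨0, fun _ ↦ ⊥, fun _ ↦ inferInstance, rfl, Subsingleton.elim _ _, fun i hi ↦ by omega⟩

theorem isSupersolvable_of_commGroup (G : Type*) [CommGroup G] [Finite G] :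
    IsSupersolvable G := by
  induction hn : Nat.card G using Nat.strong_induction_on generalizing G with
  | _ n ih =>
    rcases subsingleton_or_nontrivial G with h | h
    · exact isSupersolvable_of_subsingleton G
    · obtain ⟨g, hg⟩ := exists_ne (1 : G)
      refine IsSupersolvable.of_quotient (Subgroup.zpowers g) inferInstance (ih _ ?_ _ rfl)
      have h1 := (Subgroup.zpowers g).card_mul_index
      have h2 : 1 < Nat.card (Subgroup.zpowers g) := by
        rw [Subgroup.one_lt_card_iff_ne_bot]
        simpa using hg
      have h3 : 0 < (Subgroup.zpowers g).index := Nat.pos_of_ne_zero Subgroup.index_ne_zero_of_finite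
      change (Subgroup.zpowers g).index < n
      nlinarith

theorem isSupersolvable_of_isCyclic_commutator (G : Type*) [Group G] [Finite G]
    (h : IsCyclic (commutator G)) : IsSupersolvable G := by
  have : Finite (Abelianization G) := inferInstanceAs (Finite (G ⧸ commutator G))
  exact .of_quotient (commutator G) h (isSupersolvable_of_commGroup (Abelianization G))

/-! ### Isoclinism to `A₄` -/

theorem commutator_quotient {G : Type*} [Group G] (N : Subgroup G) [N.Normal] :
    commutator (G ⧸ N) = (commutator G).map (QuotientGroup.mk' N) := by
  rw [commutator_def, commutator_def, Subgroup.map_commutator, ← MonoidHom.range_eq_map,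
    MonoidHom.range_eq_top.2 (QuotientGroup.mk'_surjective N)]

theorem card_mul_card_commutator_quotient {G : Type*} [Group G] (N : Subgroup G)
    [N.Normal] (hN : N ≤ commutator G) :
    Nat.card N * Nat.card (commutator (G ⧸ N)) = Nat.card (commutator G) := by
  rw [commutator_quotient, mul_comm]
  have h := Subgroup.card_mul_index (N.subgroupOf (commutator G))
  rw [Nat.card_congr (Subgroup.subgroupOfEquivOfLe hN).toEquiv] at h
  rw [← h, mul_comm]
  congr 1
  have := (commutator G).relIndex_ker (QuotientGroup.mk' N)
  rw [QuotientGroup.ker_mk'] at this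
  exact this.symm

/-- The group `G` has a quotient isomorphic to `A₄` by a normal subgroup that meets the derived
subgroup trivially. It is encoded by the surjection onto `A₄`. -/
def HasA4Quotient (G : Type*) [Group G] : Prop :=
  ∃ π : G →* alternatingGroup (Fin 4), Function.Surjective π ∧ Disjoint π.ker (commutator G)

theorem mem_center_of_forall_commutatorElement {G : Type*} [Group G] {z : G}
    (h : ∀ g : G, ⁅z, g⁆ = 1) : z ∈ Subgroup.center G :=
  Subgroup.mem_center_iff.2 fun g ↦ (commutatorElement_eq_one_iff_mul_comm.1 (h g)).symm

theorem comap_center_of_disjoint_ker_commutator {G H : Type*} [Group G] [Group H] (π : G →* H)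
    (hπ : Function.Surjective π) (hd : Disjoint π.ker (commutator G)) :
    (Subgroup.center H).comap π = Subgroup.center G := by
  ext z
  constructor
  · intro hz
    refine mem_center_of_forall_commutatorElement fun g ↦ ?_
    refine Subgroup.disjoint_def.1 hd ?_ (commutatorElement_mem_commutator_self z g)
    rw [MonoidHom.mem_ker, map_commutatorElement, commutatorElement_eq_one_iff_mul_comm]
    exact (Subgroup.mem_center_iff.1 hz _).symm
  · intro hz
    refine Subgroup.mem_center_iff.2 fun h ↦ ?_
    obtain ⟨g, rfl⟩ := hπ h
    rw [← map_mul, ← map_mul, Subgroup.mem_center_iff.1 hz]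

/-- A quotient of `G` by a normal subgroup that meets `G'` trivially is isoclinic to `G`: such a
subgroup is central, and `Z(G)` is the preimage of the centre of the quotient. -/
theorem isoclinic_of_disjoint_ker_commutator {G H : Type*} [Group G] [Group H] (π : G →* H)
    (hπ : Function.Surjective π) (hd : Disjoint π.ker (commutator G)) : Isoclinic G H := by
  have hZ := comap_center_of_disjoint_ker_commutator π hπ hd
  have hmap : (commutator G).map π = commutator H := by
    rw [commutator_def, commutator_def, Subgroup.map_commutator, ← MonoidHom.range_eq_map,
      MonoidHom.range_eq_top.2 hπ]
  let φ : G ⧸ Subgroup.center G →* H ⧸ Subgroup.center H := QuotientGroup.map _ _ π hZ.ge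
  have hφ : Function.Bijective φ := by
    constructor
    · rw [← MonoidHom.ker_eq_bot_iff, QuotientGroup.ker_map, hZ]
      simp
    · intro y
      obtain ⟨h, rfl⟩ := QuotientGroup.mk_surjective y
      obtain ⟨g, rfl⟩ := hπ h
      exact ⟨g, rfl⟩
  let ψ₀ : commutator G →* H := π.comp (commutator G).subtype
  let ψ : commutator G →* commutator H := ψ₀.codRestrict (commutator H) fun x ↦ by
    rw [← hmap]
    exact ⟨x, x.2, rfl⟩
  have hψ : Function.Bijective ψ := by
    constructor
    · rw [← MonoidHom.ker_eq_bot_iff, eq_bot_iff]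
      intro x hx
      have hx' : π x = 1 := congrArg Subtype.val (show ψ x = 1 from hx)
      exact Subtype.ext (Subgroup.disjoint_def.1 hd hx' x.2)
    · rintro ⟨y, hy⟩
      rw [← hmap] at hy
      obtain ⟨x, hx, rfl⟩ := hy
      exact ⟨⟨x, hx⟩, rfl⟩
  refine ⟨MulEquiv.ofBijective φ hφ, MulEquiv.ofBijective ψ hψ, fun g₁ g₂ h₁ h₂ e₁ e₂ ↦ ?_⟩
  apply Subtype.ext
  change π ⁅g₁, g₂⁆ = ⁅h₁, h₂⁆
  obtain ⟨z₁, hz₁⟩ : ∃ z, z ∈ Subgroup.center H ∧ h₁ = π g₁ * z :=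
    ⟨(π g₁)⁻¹ * h₁, QuotientGroup.eq.1 e₁, by group⟩
  obtain ⟨z₂, hz₂⟩ : ∃ z, z ∈ Subgroup.center H ∧ h₂ = π g₂ * z :=
    ⟨(π g₂)⁻¹ * h₂, QuotientGroup.eq.1 e₂, by group⟩
  rw [hz₁.2, hz₂.2, map_commutatorElement]
  have c₁ := fun g ↦ (Subgroup.mem_center_iff.1 hz₁.1 g)
  have c₂ := fun g ↦ (Subgroup.mem_center_iff.1 hz₂.1 g)
  simp only [commutatorElement_def, mul_inv_rev]
  have e1 : π g₁ * z₁ * (π g₂ * z₂) * (z₁⁻¹ * (π g₁)⁻¹) * (z₂⁻¹ * (π g₂)⁻¹)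
      = π g₁ * (z₁ * (π g₂ * z₂)) * (z₁⁻¹ * (π g₁)⁻¹) * (z₂⁻¹ * (π g₂)⁻¹) := by group
  rw [e1, ← c₁ (π g₂ * z₂)]
  have e2 : π g₁ * (π g₂ * z₂ * z₁) * (z₁⁻¹ * (π g₁)⁻¹) * (z₂⁻¹ * (π g₂)⁻¹)
      = π g₁ * π g₂ * (z₂ * (π g₁)⁻¹) * (z₂⁻¹ * (π g₂)⁻¹) := by group
  rw [e2, ← c₂]
  group

theorem HasA4Quotient.isoclinic {G : Type*} [Group G] (h : HasA4Quotient G) :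
    Isoclinic G (alternatingGroup (Fin 4)) :=
  let ⟨π, hπ, hd⟩ := h
  isoclinic_of_disjoint_ker_commutator π hπ hd

theorem center_alternatingGroup_fin_four :
    Subgroup.center (alternatingGroup (Fin 4)) = ⊥ := by
  rw [eq_bot_iff]
  intro z hz
  rw [Subgroup.mem_center_iff] at hz
  rw [Subgroup.mem_bot]
  revert z
  decide

/-- If `G / M → A₄` is as in `HasA4Quotient`, with `M` central, then `Z(G)` lies in the kernel of
`G → A₄` because `A₄` has trivial centre, and the induced map `G / Z(G) → A₄` is again injective on
the derived subgroup. -/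
theorem HasA4Quotient.isoclinic_quotient_center {G : Type*} [Group G] (M : Subgroup G) [M.Normal]
    (hM : M ≤ Subgroup.center G) (h : HasA4Quotient (G ⧸ M)) :
    Isoclinic (G ⧸ Subgroup.center G) (alternatingGroup (Fin 4)) := by
  obtain ⟨π, hπ, hd⟩ := h
  let ρ := π.comp (QuotientGroup.mk' M)
  have hρ : Function.Surjective ρ := hπ.comp (QuotientGroup.mk'_surjective M)
  have hk : Subgroup.center G ≤ ρ.ker := by
    intro z hz
    rw [MonoidHom.mem_ker, ← Subgroup.mem_bot, ← center_alternatingGroup_fin_four,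
      Subgroup.mem_center_iff]
    intro a
    obtain ⟨g, rfl⟩ := hρ a
    rw [← map_mul, ← map_mul, Subgroup.mem_center_iff.1 hz]
  refine isoclinic_of_disjoint_ker_commutator (QuotientGroup.lift _ ρ hk)
    (QuotientGroup.lift_surjective_of_surjective _ _ hρ _) ?_
  rw [Subgroup.disjoint_def]
  intro x hx hx'
  rw [commutator_quotient] at hx'
  obtain ⟨g, hg, rfl⟩ := hx'
  have h1 : (QuotientGroup.mk' M g) ∈ π.ker := hx
  have h2 : (QuotientGroup.mk' M g) ∈ commutator (G ⧸ M) := by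
    rw [commutator_quotient]; exact ⟨g, hg, rfl⟩
  have h3 := Subgroup.disjoint_def.1 hd h1 h2
  exact (QuotientGroup.eq_one_iff g).2 (hM ((QuotientGroup.eq_one_iff g).1 h3))

/-! ### Groups with derived subgroup of order four -/

theorem inv_mul_mem_centralizer_of_commutatorElement_eq {G : Type*} [Group G] {a b x : G}
    (h : ⁅a, x⁆ = ⁅b, x⁆) : a⁻¹ * b ∈ Subgroup.centralizer {x} := by
  rw [Subgroup.mem_centralizer_singleton_iff]
  rw [commutatorElement_def, commutatorElement_def, mul_left_inj] at h
  calc a⁻¹ * b * x = a⁻¹ * (b * x * b⁻¹) * b := by group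
    _ = x * (a⁻¹ * b) := by rw [← h]; group

/-- The map `g ↦ ⁅g, x⁆` is injective on the cosets of the centralizer of `x`. -/
theorem index_centralizer_le_card_commutator {G : Type*} [Group G] [Finite G] (x : G) :
    (Subgroup.centralizer {x}).index ≤ Nat.card (commutator G) := by
  let f : G ⧸ Subgroup.centralizer {x} → commutator G := Quotient.lift
    (fun g ↦ ⟨⁅g, x⁆, commutatorElement_mem_commutator_self g x⟩) (by
      intro a b hab
      have h := QuotientGroup.leftRel_apply.1 hab
      rw [Subgroup.mem_centralizer_singleton_iff] at h
      have h' : b = a * (a⁻¹ * b) := by group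
      apply Subtype.ext
      change ⁅a, x⁆ = ⁅b, x⁆
      rw [h', commutatorElement_def, commutatorElement_def, mul_assoc a _ x, h]
      group)
  refine Nat.card_le_card_of_injective f ?_
  intro a b
  refine Quotient.inductionOn₂ a b fun a b hab ↦ Quotient.sound ?_
  exact QuotientGroup.leftRel_apply.2
    (inv_mul_mem_centralizer_of_commutatorElement_eq (congrArg Subtype.val hab))

theorem card_mul_card_le_of_disjoint {G : Type*} [Group G] [Finite G] {H K : Subgroup G}
    (h : Disjoint H K) : Nat.card H * Nat.card K ≤ Nat.card G := by
  rw [← Nat.card_prod]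
  exact Nat.card_le_card_of_injective _ (Subgroup.mul_injective_of_disjoint h)

theorem disjoint_centralizer_iff {G : Type*} [Group G] {V : Subgroup G} {x : G} :
    Disjoint (Subgroup.centralizer {x}) V ↔ ∀ v ∈ V, v * x = x * v → v = 1 := by
  rw [Subgroup.disjoint_def]
  simp only [Subgroup.mem_centralizer_singleton_iff]
  exact ⟨fun h v hv hx ↦ h hx hv, fun h v hx hv ↦ h v hv hx⟩

theorem eq_alternatingGroup_fin_four_of_card {R : Subgroup (Equiv.Perm (Fin 4))}
    (h4 : 4 ∣ Nat.card R) (h3 : 3 ∣ Nat.card R) (hR : R ≠ ⊤) : R = alternatingGroup (Fin 4) := by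
  have hcard : Nat.card (Equiv.Perm (Fin 4)) = 24 := by
    simp [Fintype.card_perm, Nat.factorial]
  apply Equiv.Perm.eq_alternatingGroup_of_index_eq_two
  have h1 := R.card_mul_index
  have h2 : R.index ≠ 1 := fun h ↦ hR (Subgroup.index_eq_one.1 h)
  rw [hcard] at h1
  obtain ⟨k, hk⟩ : 12 ∣ Nat.card R :=
    (show Nat.Coprime 4 3 by decide).mul_dvd_of_dvd_of_dvd h4 h3
  rw [hk, mul_assoc] at h1
  have h5 : k * R.index = 2 := by omega
  exact ((Nat.dvd_prime Nat.prime_two).1 (Dvd.intro_left k h5)).resolve_left h2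

/-- If `|G'| = 4` and some `x` commutes with no nontrivial element of `G'`, then the action of `G`
on the four cosets of the centralizer of `x` is a surjection onto `A₄` that is injective on `G'`. -/
theorem hasA4Quotient_of_disjoint_centralizer {G : Type*} [Group G] [Finite G]
    (h4 : Nat.card (commutator G) = 4) {x : G}
    (hx : Disjoint (Subgroup.centralizer {x}) (commutator G)) : HasA4Quotient G := by
  classical
  let H := Subgroup.centralizer {x}
  have hindex : H.index = 4 := by
    have h1 := index_centralizer_le_card_commutator x
    have h2 := card_mul_card_le_of_disjoint hx
    rw [← H.card_mul_index] at h2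
    have h3 := Nat.le_of_mul_le_mul_left h2 Nat.card_pos
    exact le_antisymm (h4 ▸ h1) (h4 ▸ h3)
  let e : G ⧸ H ≃ Fin 4 := Finite.equivFinOfCardEq hindex
  let π : G →* Equiv.Perm (Fin 4) :=
    e.permCongrHom.toMonoidHom.comp (MulAction.toPermHom G (G ⧸ H))
  have hker : Disjoint π.ker (commutator G) := by
    refine hx.mono_left ?_
    have : π.ker = (MulAction.toPermHom G (G ⧸ H)).ker := by
      ext g
      simp [π, MonoidHom.mem_ker]
    rw [this, ← Subgroup.normalCore_eq_ker]
    exact H.normalCore_le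
  have hcardmap : Nat.card ((commutator G).map π) = 4 := by
    refine Eq.trans ?_ h4
    refine (Nat.card_congr (Equiv.ofBijective (π.subgroupMap (commutator G)) ⟨?_,
      π.subgroupMap_surjective _⟩)).symm
    rw [injective_iff_map_eq_one]
    intro v hv
    have hv' : π v = 1 := congrArg Subtype.val hv
    exact Subtype.ext (Subgroup.disjoint_def.1 hker hv' v.2)
  have hR : π.range = alternatingGroup (Fin 4) := by
    apply eq_alternatingGroup_fin_four_of_card
    · refine hcardmap.symm.dvd.trans (Subgroup.card_dvd_of_le ?_)
      rintro _ ⟨g, -, rfl⟩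
      exact ⟨g, rfl⟩
    -- Otherwise the image of `G` has order dividing `8`, so conjugation by `x` is a permutation of
    -- `2`-power order of the four elements of `G'`, and cannot have just one fixed point.
    · by_contra h3
      have h8 : Nat.card π.range ∣ 8 := by
        have h24 : Nat.card π.range ∣ 3 * 8 := by
          have := Subgroup.card_subgroup_dvd_card π.range
          rwa [show Nat.card (Equiv.Perm (Fin 4)) = 3 * 8 by
            simp [Fintype.card_perm, Nat.factorial]] at this
        exact (((Nat.Prime.coprime_iff_not_dvd Nat.prime_three).2 h3).symm).dvd_of_dvd_mul_left h24
      have hx8 : x ^ 8 ∈ π.ker := by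
        rw [MonoidHom.mem_ker, map_pow]
        obtain ⟨k, hk⟩ := h8
        have : (⟨π x, x, rfl⟩ : π.range) ^ Nat.card π.range = 1 := pow_card_eq_one'
        have := congrArg Subtype.val this
        rw [hk, pow_mul]
        simp only [Subgroup.coe_pow, Subgroup.coe_one] at this
        rw [this, one_pow]
      let σ : Equiv.Perm (commutator G) :=
        MulAut.toPerm _ (MulAut.conjNormal x)
      have hσ8 : σ ^ 2 ^ 3 = 1 := by
        rw [← map_pow, ← map_pow]
        ext v
        have hc : Commute (x ^ 8) v :=
          Subgroup.commute_of_normal_of_disjoint _ _ inferInstance inferInstance hker _ _ hx8 v.2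
        change ((MulAut.conjNormal (x ^ 2 ^ 3) v : commutator G) : G) = v
        rw [MulAut.conjNormal_apply]
        exact mul_inv_eq_of_eq_mul hc
      have := Fintype.ofFinite (commutator G)
      have h := Equiv.Perm.card_compl_support_modEq hσ8
      have hsupp : σ.supportᶜ = {1} := by
        ext v
        simp only [Finset.mem_compl, Equiv.Perm.mem_support, not_not, Finset.mem_singleton]
        constructor
        · intro hv
          have hv' : x * v * x⁻¹ = v := by
            rw [← MulAut.conjNormal_apply]
            exact congrArg Subtype.val hv
          exact Subtype.ext (disjoint_centralizer_iff.1 hx v v.2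
            (mul_inv_eq_iff_eq_mul.1 hv').symm)
        · rintro rfl
          exact map_one (MulAut.conjNormal x : MulAut (commutator G))
      rw [hsupp, ← Nat.card_eq_fintype_card, h4, Finset.card_singleton] at h
      exact absurd h (by decide)
    -- If the image were all of `S₄`, the four-element image of `G'` would contain a `3`-cycle.
    · intro htop
      obtain ⟨g, hg⟩ := MonoidHom.range_eq_top.1 htop (Equiv.swap 0 1)
      obtain ⟨h, hh⟩ := MonoidHom.range_eq_top.1 htop (Equiv.swap 1 2)
      have hmem : ⁅(Equiv.swap 0 1 : Equiv.Perm (Fin 4)), Equiv.swap 1 2⁆ ∈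
          (commutator G).map π :=
        ⟨⁅g, h⁆, commutatorElement_mem_commutator_self g h, by
          rw [map_commutatorElement, hg, hh]⟩
      have h1 : (⟨_, hmem⟩ : (commutator G).map π) ^ 4 = 1 :=
        orderOf_dvd_iff_pow_eq_one.1 ((orderOf_dvd_natCard _).trans hcardmap.dvd)
      have h2 := congrArg Subtype.val h1
      revert h2
      simp only [Subgroup.coe_pow, Subgroup.coe_one, commutatorElement_def]
      decide
  refine ⟨π.codRestrict _ fun g ↦ hR.le ⟨g, rfl⟩, ?_, ?_⟩
  · rintro ⟨a, ha⟩
    obtain ⟨g, hg⟩ := hR.ge ha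
    exact ⟨g, Subtype.ext hg⟩
  · rw [MonoidHom.ker_codRestrict]
    exact hker

/-! ### Minimal normal subgroups -/

/-- A minimal normal subgroup: minimal among the nontrivial normal subgroups. -/
def IsMinimalNormal {G : Type*} [Group G] (V : Subgroup G) : Prop :=
  Minimal (fun K : Subgroup G ↦ K.Normal ∧ K ≠ ⊥) V

namespace IsMinimalNormal

variable {G : Type*} [Group G] {V : Subgroup G}

theorem normal (hV : IsMinimalNormal V) : V.Normal := hV.prop.1

theorem ne_bot (hV : IsMinimalNormal V) : V ≠ ⊥ := hV.prop.2

theorem eq_bot_or_eq (hV : IsMinimalNormal V) {K : Subgroup G} (hK : K.Normal) (hle : K ≤ V) :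
    K = ⊥ ∨ K = V := by
  by_cases h : K = ⊥
  · exact .inl h
  · exact .inr (hV.eq_of_le ⟨hK, h⟩ hle)

theorem exists_le [Finite G] {N : Subgroup G} [hN : N.Normal] (h : N ≠ ⊥) :
    ∃ V ≤ N, IsMinimalNormal V :=
  exists_minimal_le_of_wellFoundedLT (fun K : Subgroup G ↦ K.Normal ∧ K ≠ ⊥) N ⟨hN, h⟩

theorem eq_zpowers (hV : IsMinimalNormal V) {v : G} (hv : v ∈ V) (hv1 : v ≠ 1)
    (hn : (Subgroup.zpowers v).Normal) : Subgroup.zpowers v = V :=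
  (hV.eq_bot_or_eq hn (by simpa using hv)).resolve_left (by simpa using hv1)

/-- A minimal normal subgroup inside a normal `p`-subgroup `P` is central in `P`: the `p`-group `P`
has a nontrivial fixed point in its conjugation action on `V`. -/
theorem le_centralizer_of_isPGroup [Finite G] (hV : IsMinimalNormal V) {p : ℕ} [Fact p.Prime]
    {P : Subgroup G} [P.Normal] (hP : IsPGroup p P) (hle : V ≤ P) :
    V ≤ Subgroup.centralizer P := by
  have := hV.normal
  have hinf := hV.eq_bot_or_eq (K := V ⊓ Subgroup.centralizer P) inferInstance inf_le_left
  refine inf_eq_left.1 (hinf.resolve_left ?_)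
  let _ : MulAction P V :=
    MulAction.compHom V ((MulAut.conjNormal : G →* MulAut V).comp P.subtype)
  have hsmul (g : P) (v : V) : ((g • v : V) : G) = g * v * (g : G)⁻¹ :=
    MulAut.conjNormal_apply _ _
  have hpV : p ∣ Nat.card V := by
    obtain ⟨n, hn⟩ := IsPGroup.iff_card.1 (hP.to_le hle)
    rw [hn]
    refine dvd_pow_self p ?_
    rintro rfl
    exact hV.ne_bot (Subgroup.eq_bot_of_card_eq V (by simpa using hn))
  obtain ⟨b, hb, hb1⟩ := hP.exists_fixed_point_of_prime_dvd_card_of_fixed_point V hpV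
    (a := 1) (fun g ↦ Subtype.ext (by simp [hsmul]))
  intro hbot
  apply hb1
  have hbmem : (b : G) ∈ V ⊓ Subgroup.centralizer P := by
    refine ⟨b.2, Subgroup.mem_centralizer_iff.2 fun g hg ↦ ?_⟩
    have := congrArg Subtype.val (hb ⟨g, hg⟩)
    rw [hsmul] at this
    exact mul_inv_eq_iff_eq_mul.1 this
  rw [hbot, Subgroup.mem_bot] at hbmem
  exact (Subtype.ext hbmem).symm

end IsMinimalNormal

/-- If `V` centralizes `G'`, then `C_V(x)` depends only on the coset of `x` modulo `G'`, so it is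
normal in `G`. -/
theorem normal_centralizer_singleton_inf {G : Type*} [Group G] {V : Subgroup G} [hV : V.Normal]
    (hc : V ≤ Subgroup.centralizer (commutator G)) (x : G) :
    (Subgroup.centralizer {x} ⊓ V).Normal := by
  refine ⟨fun v ⟨hvx, hv⟩ g ↦ ⟨?_, hV.conj_mem v hv g⟩⟩
  have h1 : x * v = v * x := ((Subgroup.mem_centralizer_singleton_iff).1 hvx).symm
  have h2 := (Subgroup.mem_centralizer_iff.1 (hc hv) ⁅x⁻¹, g⁻¹⁆
    (commutatorElement_mem_commutator_self _ _))
  refine Subgroup.mem_centralizer_singleton_iff.2 ?_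
  have h3 : g⁻¹ * x * g = x * ⁅x⁻¹, g⁻¹⁆ := by
    rw [commutatorElement_def]
    group
  calc g * v * g⁻¹ * x = g * (v * (g⁻¹ * x * g)) * g⁻¹ := by group
    _ = g * (v * x * ⁅x⁻¹, g⁻¹⁆) * g⁻¹ := by rw [h3, mul_assoc v]
    _ = g * (x * (⁅x⁻¹, g⁻¹⁆ * v)) * g⁻¹ := by rw [← h1, mul_assoc x, h2]
    _ = g * (g⁻¹ * x * g * v) * g⁻¹ := by rw [h3, mul_assoc x]
    _ = x * (g * v * g⁻¹) := by group

namespace IsMinimalNormal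

variable {G : Type*} [Group G] {V : Subgroup G}

theorem disjoint_centralizer_singleton (hV : IsMinimalNormal V)
    (hc : V ≤ Subgroup.centralizer (commutator G)) {x : G}
    (hx : x ∉ Subgroup.centralizer (V : Set G)) : Disjoint (Subgroup.centralizer {x}) V := by
  have := hV.normal
  rcases hV.eq_bot_or_eq (normal_centralizer_singleton_inf hc x) inf_le_right with h | h
  · exact disjoint_iff.2 h
  · refine absurd (Subgroup.mem_centralizer_iff.2 fun v hv ↦ ?_) hx
    exact Subgroup.mem_centralizer_singleton_iff.1 (inf_eq_right.1 h hv)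

/-- If `C_G(V)` had index at most two, then for `v ∈ V` and `g` outside `C_G(V)` the product of `v`
and its conjugate by `g` would be fixed by `g`, hence trivial. So `g` would invert `V`, and `V`,
having all its subgroups normal in `G`, would be cyclic. -/
theorem three_le_index_centralizer [Finite G] (hV : IsMinimalNormal V) (hcyc : ¬ IsCyclic V)
    (hle : V ≤ commutator G) (hc : V ≤ Subgroup.centralizer (commutator G)) :
    3 ≤ (Subgroup.centralizer (V : Set G)).index := by
  by_contra! hlt
  have hsq (g : G) : g ^ 2 ∈ Subgroup.centralizer (V : Set G) := by
    have : (Subgroup.centralizer (V : Set G)).index ≠ 0 := Subgroup.index_ne_zero_of_finite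
    rcases (by omega : (Subgroup.centralizer (V : Set G)).index = 1 ∨
      (Subgroup.centralizer (V : Set G)).index = 2) with h | h
    · rw [Subgroup.index_eq_one.1 h]
      trivial
    · exact Subgroup.sq_mem_of_index_two h g
  have hcomm {v w : G} (hv : v ∈ V) (hw : w ∈ V) : v * w = w * v :=
    Subgroup.mem_centralizer_iff.1 (hc hw) v (hle hv)
  have hn := hV.normal
  obtain ⟨v, hv, hv1⟩ := V.bot_or_exists_ne_one.resolve_left hV.ne_bot
  have hconj (g : G) : g * v * g⁻¹ ∈ Subgroup.zpowers v := by
    by_cases hg : g ∈ Subgroup.centralizer (V : Set G)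
    · rw [← Subgroup.mem_centralizer_iff.1 hg v hv, mul_inv_cancel_right]
      exact Subgroup.mem_zpowers v
    · have hgv := hn.conj_mem v hv g
      have h2 := Subgroup.mem_centralizer_iff.1 (hsq g) v hv
      have h1 := disjoint_centralizer_iff.1 (hV.disjoint_centralizer_singleton hc hg)
        (v * (g * v * g⁻¹)) (mul_mem hv hgv) (by
          calc v * (g * v * g⁻¹) * g = v * g * v := by group
            _ = v * g ^ 2 * g⁻¹ * v := by group
            _ = g * (g * v * g⁻¹ * v) := by rw [h2, pow_two]; group
            _ = g * (v * (g * v * g⁻¹)) := by rw [hcomm hv hgv])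
      rw [(inv_eq_of_mul_eq_one_right h1).symm]
      exact inv_mem (Subgroup.mem_zpowers v)
  have hz : (Subgroup.zpowers v).Normal := by
    refine ⟨fun w hw g ↦ ?_⟩
    obtain ⟨k, rfl⟩ := Subgroup.mem_zpowers_iff.1 hw
    rw [← conj_zpow]
    exact zpow_mem (hconj g) k
  have h := hV.eq_zpowers hv hv1 hz
  exact hcyc (h ▸ inferInstance)

end IsMinimalNormal

/-! ### Counting commuting pairs -/

theorem commProb_eq_sum_card_centralizer (G : Type*) [Group G] [Fintype G] :
    commProb G = (∑ g : G, (Nat.card (Subgroup.centralizer {g}) : ℚ)) / (Nat.card G : ℚ) ^ 2 := by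
  rw [commProb_def, ← Nat.cast_sum, ← Nat.card_sigma]
  congr 2
  refine Nat.card_congr ⟨fun p ↦ ⟨p.1.1, p.1.2, ?_⟩, fun s ↦ ⟨(s.1, s.2.1), ?_⟩,
    fun _ ↦ rfl, fun _ ↦ rfl⟩
  · exact Subgroup.mem_centralizer_singleton_iff.2 p.2.eq.symm
  · exact (Subgroup.mem_centralizer_singleton_iff.1 s.2.2).symm

theorem card_mul_card_le_of_disjoint_of_le {G : Type*} [Group G] [Finite G] {H K L : Subgroup G}
    (h : Disjoint H K) (hH : H ≤ L) (hK : K ≤ L) : Nat.card H * Nat.card K ≤ Nat.card L := by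
  have := card_mul_card_le_of_disjoint (H := H.subgroupOf L) (K := K.subgroupOf L) (by
    rw [Subgroup.disjoint_def] at h ⊢
    exact fun {x} hx hx' ↦ Subtype.ext (h hx hx'))
  rwa [Nat.card_congr (Subgroup.subgroupOfEquivOfLe hH).toEquiv,
    Nat.card_congr (Subgroup.subgroupOfEquivOfLe hK).toEquiv] at this

/-- The bound for `d(G)` when `q = |V| ≥ 6`. Centralizers of elements outside `C = C_G(V)` have order
at most `|G| / q`, those of noncentral elements of `C` have order at most `|G| / 2`, and
`3 |C| ≤ |G|`, `q |Z(G)| ≤ |C|`. Altogether `d(G) ≤ 1/6 + 5/(6q) ≤ 11/36 < 5/16`. -/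
theorem IsMinimalNormal.commProb_le {G : Type*} [Group G] [Finite G] {V : Subgroup G}
    (hV : IsMinimalNormal V) (hcyc : ¬ IsCyclic V)
    (hle : V ≤ commutator G) (hc : V ≤ Subgroup.centralizer (commutator G))
    (hq : 6 ≤ Nat.card V) : commProb G ≤ 5 / 16 := by
  classical
  have := Fintype.ofFinite G
  have hVn := hV.normal
  set C := Subgroup.centralizer (V : Set G) with hC
  have h3 := hV.three_le_index_centralizer hcyc hle hc
  have hCcard : 3 * Nat.card C ≤ Nat.card G := by
    rw [← C.card_mul_index, mul_comm]
    exact Nat.mul_le_mul_left _ h3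
  have hZC : Subgroup.center G ≤ C := Subgroup.center_le_centralizer _
  have hVC : V ≤ C := hc.trans (Subgroup.centralizer_le hle)
  have hdisj : Disjoint (Subgroup.center G) V := by
    rcases hV.eq_bot_or_eq (K := Subgroup.center G ⊓ V) inferInstance inf_le_right with h | h
    · exact disjoint_iff.2 h
    · have hVZ : V ≤ Subgroup.center G := inf_eq_right.1 h
      have : C = ⊤ := Subgroup.centralizer_eq_top_iff_subset.2 hVZ
      rw [← hC, this, Subgroup.index_top] at h3
      omega
  have hZcard : Nat.card (Subgroup.center G) * Nat.card V ≤ Nat.card C :=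
    card_mul_card_le_of_disjoint_of_le hdisj hZC hVC
  set n : ℚ := ((Nat.card G : ℕ) : ℚ) with hn
  set q : ℚ := ((Nat.card V : ℕ) : ℚ) with hqdef
  set c : ℚ := ((Nat.card C : ℕ) : ℚ) with hcdef
  set z : ℚ := ((Nat.card (Subgroup.center G) : ℕ) : ℚ) with hzdef
  have hn0 : 0 < n := Nat.cast_pos.2 Nat.card_pos
  have hq6 : 6 ≤ q := by rw [hqdef]; exact_mod_cast hq
  have hq0 : 0 < q := by linarith
  have hcn : 3 * c ≤ n := by rw [hcdef, hn]; exact_mod_cast hCcard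
  have hzc : z * q ≤ c := by rw [hzdef, hqdef, hcdef]; exact_mod_cast hZcard
  have hpoint (g : G) : (Nat.card (Subgroup.centralizer {g}) : ℚ) ≤
      n / q + (if g ∈ C then n / 2 - n / q else 0) +
        (if g ∈ Subgroup.center G then n / 2 else 0) := by
    by_cases hgC : g ∈ C
    · by_cases hgZ : g ∈ Subgroup.center G
      · rw [if_pos hgC, if_pos hgZ]
        have : (Nat.card (Subgroup.centralizer {g}) : ℚ) ≤ n := by
          rw [hn]
          exact_mod_cast Subgroup.card_le_card_group _
        linarith
      · rw [if_pos hgC, if_neg hgZ]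
        have hidx : 2 ≤ (Subgroup.centralizer {g}).index := by
          have h0 : (Subgroup.centralizer {g}).index ≠ 0 := Subgroup.index_ne_zero_of_finite
          have h1 : (Subgroup.centralizer {g}).index ≠ 1 := fun h ↦ hgZ (by
            have := Subgroup.centralizer_eq_top_iff_subset.1 (Subgroup.index_eq_one.1 h)
            exact this rfl)
          omega
        have h2 : Nat.card (Subgroup.centralizer {g}) * 2 ≤ Nat.card G := by
          rw [← (Subgroup.centralizer {g}).card_mul_index]
          exact Nat.mul_le_mul_left _ hidx
        have h2' : (Nat.card (Subgroup.centralizer {g}) : ℚ) * 2 ≤ n := by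
          rw [hn]; exact_mod_cast h2
        linarith
    · have hgZ : g ∉ Subgroup.center G := fun h ↦ hgC (hZC h)
      rw [if_neg hgC, if_neg hgZ, add_zero, add_zero, le_div_iff₀ hq0, hn, hqdef]
      exact_mod_cast card_mul_card_le_of_disjoint (hV.disjoint_centralizer_singleton hc hgC)
  have hsum : (∑ g : G, (Nat.card (Subgroup.centralizer {g}) : ℚ)) ≤
      n * (n / q) + c * (n / 2 - n / q) + z * (n / 2) := by
    refine (Finset.sum_le_sum fun g _ ↦ hpoint g).trans_eq ?_
    rw [Finset.sum_add_distrib, Finset.sum_add_distrib, ← Finset.sum_filter, ← Finset.sum_filter]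
    simp only [Finset.sum_const, nsmul_eq_mul, Finset.card_univ, ← Fintype.card_subtype]
    simp only [hn, hcdef, hzdef, Nat.card_eq_fintype_card]
  rw [commProb_eq_sum_card_centralizer, div_le_iff₀ (by positivity)]
  refine hsum.trans ?_
  have hz : z ≤ c / q := (le_div_iff₀ hq0).2 hzc
  have hq' : 1 / q ≤ 1 / 6 := one_div_le_one_div_of_le (by norm_num) hq6
  calc n * (n / q) + c * (n / 2 - n / q) + z * (n / 2)
      ≤ n * (n / q) + c * (n / 2 - n / q) + c / q * (n / 2) := by gcongr
    _ = n * (n * (1 / q) + c * ((1 - 1 / q) / 2)) := by field_simp; ring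
    _ ≤ n * (n * (1 / q) + n / 3 * ((1 - 1 / q) / 2)) := by
        gcongr <;> linarith
    _ = n ^ 2 * (1 / 6 + 5 / 6 * (1 / q)) := by ring
    _ ≤ n ^ 2 * (5 / 16) := by gcongr; linarith
    _ = 5 / 16 * n ^ 2 := mul_comm _ _

/-! ### Noncyclic minimal normal subgroups of small order -/

theorem Subgroup.le_center_of_card_eq_two {G : Type*} [Group G] {M : Subgroup G} [hn : M.Normal]
    (hM : Nat.card M = 2) : M ≤ Subgroup.center G := by
  intro m hm
  refine Subgroup.mem_center_iff.2 fun g ↦ ?_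
  by_cases hm1 : m = 1
  · simp [hm1]
  have hcard := Nat.card_eq_two_iff' (1 : M) |>.1 hM
  have h := hcard.unique (y₁ := ⟨m, hm⟩) (y₂ := ⟨g * m * g⁻¹, hn.conj_mem m hm g⟩)
    (fun h ↦ hm1 (congrArg Subtype.val h))
    (fun h ↦ hm1 (conj_eq_one_iff.1 (congrArg Subtype.val h)))
  exact (mul_inv_eq_iff_eq_mul.1 (congrArg Subtype.val h).symm)

/-- A group of order `2p` has a characteristic subgroup of order `p`. -/
theorem IsMinimalNormal.card_ne_two_mul {G : Type*} [Group G] [Finite G] {V : Subgroup G}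
    (hV : IsMinimalNormal V) {p : ℕ} (hp : p.Prime) (h2 : p ≠ 2) : Nat.card V ≠ 2 * p := by
  intro hcard
  have := hV.normal
  have : Fact p.Prime := ⟨hp⟩
  obtain ⟨P⟩ : Nonempty (Sylow p V) := inferInstance
  have hP : Nat.card (P : Subgroup V) = p := by
    rw [P.card_eq_multiplicity, hcard,
      Nat.factorization_mul two_ne_zero hp.ne_zero]
    simp [hp.factorization_self, Nat.factorization_eq_zero_of_not_dvd
      (fun h ↦ h2 ((Nat.prime_dvd_prime_iff_eq hp Nat.prime_two).1 h))]
  have hindex : (P : Subgroup V).index = 2 := by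
    have := (P : Subgroup V).card_mul_index
    rw [hP, hcard, mul_comm 2] at this
    exact Nat.eq_of_mul_eq_mul_left hp.pos this
  have hPn := Subgroup.normal_of_index_eq_two hindex
  have := P.characteristic_of_normal hPn
  have hmap : Nat.card ((P : Subgroup V).map V.subtype) = p := by
    rw [Subgroup.card_map_of_injective V.subtype_injective, hP]
  rcases hV.eq_bot_or_eq (K := (P : Subgroup V).map V.subtype) inferInstance
    (Subgroup.map_subtype_le _) with h | h
  · rw [h, Subgroup.card_bot] at hmap
    exact hp.one_lt.ne hmap
  · rw [h, hcard] at hmap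
    have := hp.pos
    omega

/-- A group with a central subgroup of index two is abelian. -/
theorem commute_of_index_subgroupOf_eq_two {G : Type*} [Group G] {V P : Subgroup G}
    (hc : V ≤ Subgroup.centralizer P) (hindex : (V.subgroupOf P).index = 2)
    {a b : G} (ha : a ∈ P) (hb : b ∈ P) : Commute a b := by
  have hiff := Subgroup.mul_mem_iff_of_index_two hindex (a := ⟨a, ha⟩) (b := ⟨b⁻¹, inv_mem hb⟩)
  simp only [Subgroup.mem_subgroupOf, Subgroup.coe_mul, inv_mem_iff] at hiff
  by_cases haV : a ∈ V
  · exact (Subgroup.mem_centralizer_iff.1 (hc haV) b hb).symm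
  by_cases hbV : b ∈ V
  · exact Subgroup.mem_centralizer_iff.1 (hc hbV) a ha
  have h := Subgroup.mem_centralizer_iff.1 (hc (hiff.2 (by simp [haV, hbV]))) b hb
  change a * b = b * a
  calc a * b = (a * b⁻¹ * b) * b := by group
    _ = (b * (a * b⁻¹)) * b := by rw [h]
    _ = b * a := by group

/-- If `|G'| = 8` and `V` has order four, then `G'` is abelian and `M = C_{G'}(x)` is normal in `G`.
All commutators of elements of `G'` with `x` lie in `V`, so `M` is nontrivial, and it has order two
because it meets `V` trivially. Modulo `M` the element `x` has no nontrivial fixed point on `G'`. -/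
theorem exists_hasA4Quotient_of_card_commutator_eq_eight {G : Type*} [Group G] [Finite G]
    {V : Subgroup G} [hVn : V.Normal] (hle : V ≤ commutator G)
    (hc : V ≤ Subgroup.centralizer (commutator G))
    (h4 : Nat.card V = 4) (h8 : Nat.card (commutator G) = 8) {x : G}
    (hx : Disjoint (Subgroup.centralizer {x}) V) :
    ∃ (M : Subgroup G) (_ : M.Normal), M ≤ Subgroup.center G ∧ HasA4Quotient (G ⧸ M) := by
  have hindex : (V.subgroupOf (commutator G)).index = 2 := by
    have := (V.subgroupOf (commutator G)).card_mul_index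
    rw [Nat.card_congr (Subgroup.subgroupOfEquivOfLe hle).toEquiv, h4, h8] at this
    omega
  have hcomm {a b : G} (ha : a ∈ commutator G) (hb : b ∈ commutator G) : Commute a b :=
    commute_of_index_subgroupOf_eq_two hc hindex ha hb
  have hmemV {a : G} (ha : a ∈ commutator G) : ⁅a, x⁆ ∈ V := by
    have hn : (commutator G).Normal := inferInstance
    have ha' := hn.conj_mem _ (inv_mem ha) x
    have hiff := Subgroup.mul_mem_iff_of_index_two hindex (a := ⟨a, ha⟩)
      (b := ⟨x * a⁻¹ * x⁻¹, ha'⟩)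
    simp only [Subgroup.mem_subgroupOf, Subgroup.coe_mul] at hiff
    rw [commutatorElement_def, show a * x * a⁻¹ * x⁻¹ = a * (x * a⁻¹ * x⁻¹) by group, hiff,
      hVn.mem_comm_iff, inv_mul_cancel_left, V.inv_mem_iff]
  let M : Subgroup G := Subgroup.centralizer {x} ⊓ commutator G
  have hMn : M.Normal := normal_centralizer_singleton_inf (V := commutator G)
    (fun a ha ↦ Subgroup.mem_centralizer_iff.2 fun b hb ↦ hcomm hb ha) x
  have hMV : Disjoint M V := hx.mono_left inf_le_left
  have hMle : Nat.card M * Nat.card V ≤ Nat.card (commutator G) :=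
    card_mul_card_le_of_disjoint_of_le hMV inf_le_right hle
  have hM1 : 1 < Nat.card M := by
    rw [Subgroup.one_lt_card_iff_ne_bot]
    intro hbot
    -- If `M` were trivial, `a ↦ ⁅a, x⁆` would embed `G'` into `V`.
    have : Nat.card (commutator G) ≤ Nat.card V := by
      refine Nat.card_le_card_of_injective (fun a : commutator G ↦ (⟨⁅(a : G), x⁆, hmemV a.2⟩ : V))
        fun a b hab ↦ ?_
      have hmem : (a : G)⁻¹ * b ∈ M :=
        ⟨inv_mul_mem_centralizer_of_commutatorElement_eq (congrArg Subtype.val hab),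
          (commutator G).mul_mem ((commutator G).inv_mem a.2) b.2⟩
      rw [hbot, Subgroup.mem_bot] at hmem
      exact Subtype.ext (inv_mul_eq_one.1 hmem)
    omega
  have hM2 : Nat.card M = 2 := by
    rw [h4, h8] at hMle
    omega
  refine ⟨M, hMn, Subgroup.le_center_of_card_eq_two hM2, ?_⟩
  refine hasA4Quotient_of_disjoint_centralizer (x := (x : G ⧸ M)) ?_ ?_
  · have := card_mul_card_commutator_quotient M inf_le_right
    rw [hM2, h8] at this
    omega
  · rw [disjoint_centralizer_iff, commutator_quotient]
    rintro _ ⟨a, ha, rfl⟩ hax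
    have h1 : ((⁅a, x⁆ : G) : G ⧸ M) = 1 := by
      change QuotientGroup.mk' M ⁅a, x⁆ = 1
      rw [map_commutatorElement, commutatorElement_eq_one_iff_mul_comm]
      exact hax
    -- Here `⁅a, x⁆` lies in `M` and in `V`, so it is trivial.
    have h2 := Subgroup.disjoint_def.1 hMV ((QuotientGroup.eq_one_iff _).1 h1) (hmemV ha)
    exact (QuotientGroup.eq_one_iff a).2 ⟨Subgroup.mem_centralizer_singleton_iff.2
      (commutatorElement_eq_one_iff_mul_comm.1 h2), ha⟩

theorem IsMinimalNormal.exists_disjoint_centralizer {G : Type*} [Group G] [Finite G]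
    {V : Subgroup G} (hV : IsMinimalNormal V) (hcyc : ¬ IsCyclic V)
    (hle : V ≤ commutator G) (hc : V ≤ Subgroup.centralizer (commutator G)) :
    ∃ x : G, Disjoint (Subgroup.centralizer {x}) V := by
  have h3 := hV.three_le_index_centralizer hcyc hle hc
  obtain ⟨x, hx⟩ : ∃ x, x ∉ Subgroup.centralizer (V : Set G) := by
    by_contra! h
    rw [(Subgroup.eq_top_iff' _).2 h, Subgroup.index_top] at h3
    omega
  exact ⟨x, hV.disjoint_centralizer_singleton hc hx⟩

theorem IsMinimalNormal.hasA4Quotient {G : Type*} [Group G] [Finite G]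
    (hV : IsMinimalNormal (commutator G)) (hcyc : ¬ IsCyclic (commutator G))
    (h4 : Nat.card (commutator G) = 4) : HasA4Quotient G := by
  have hc := hV.le_centralizer_of_isPGroup (p := 2) (IsPGroup.of_card (n := 2) h4) le_rfl
  obtain ⟨x, hx⟩ := hV.exists_disjoint_centralizer hcyc le_rfl hc
  exact hasA4Quotient_of_disjoint_centralizer h4 hx

theorem not_isCyclic_card {G : Type*} [Group G] [Finite G] (h : ¬ IsCyclic G) :
    Nat.card G ≠ 1 ∧ ¬ (Nat.card G).Prime := by
  refine ⟨fun h1 ↦ h ?_, fun hp ↦ h ?_⟩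
  · have := (Nat.card_eq_one_iff_unique.1 h1).1
    infer_instance
  · have : Fact (Nat.card G).Prime := ⟨hp⟩
    exact isCyclic_of_prime_card rfl

theorem IsMinimalNormal.hasA4Quotient_of_lt_commProb {G : Type*} [Group G] [Finite G]
    (hG : (5 / 16 : ℚ) < commProb G) {V : Subgroup G} (hV : IsMinimalNormal V)
    (hle : V ≤ commutator G) (hcyc : ¬ IsCyclic V) :
    HasA4Quotient G ∨
      ∃ (M : Subgroup G) (_ : M.Normal), M ≤ Subgroup.center G ∧ HasA4Quotient (G ⧸ M) := by
  have h11 := card_commutator_le_of_lt_commProb hG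
  have hVn := hV.normal
  obtain ⟨hV1, hVp⟩ := not_isCyclic_card hcyc
  have hV0 : 0 < Nat.card V := Nat.card_pos
  have hG0 : 0 < Nat.card (commutator G) := Nat.card_pos
  have hdvd : Nat.card V ∣ Nat.card (commutator G) := Subgroup.card_dvd_of_le hle
  have h6 := hV.card_ne_two_mul Nat.prime_three (by decide)
  have h10 := hV.card_ne_two_mul Nat.prime_five (by decide)
  have key : Nat.card V = 4 ∧ Nat.card (commutator G) = 4 ∨
      Nat.card V = 4 ∧ Nat.card (commutator G) = 2 ^ 3 ∨
      6 ≤ Nat.card V ∧ Nat.card (commutator G) = 2 ^ 3 ∨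
      6 ≤ Nat.card V ∧ Nat.card (commutator G) = 3 ^ 2 := by
    have hVle := Nat.le_of_dvd hG0 hdvd
    generalize Nat.card V = v at *
    generalize Nat.card (commutator G) = g at *
    have hv : v = 4 ∨ v = 8 ∨ v = 9 := by
      have : v ≤ 11 := by omega
      interval_cases v <;> first | omega | exact absurd (by norm_num) hVp
    rcases hv with rfl | rfl | rfl <;> omega
  rcases key with ⟨h, h'⟩ | ⟨h, h'⟩ | ⟨h, h'⟩ | ⟨h, h'⟩
  · have hVG : V = commutator G :=
      Subgroup.eq_of_le_of_card_ge hle (by omega)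
    subst hVG
    exact .inl (hV.hasA4Quotient hcyc h)
  · have hc := hV.le_centralizer_of_isPGroup (IsPGroup.of_card h') hle
    obtain ⟨x, hx⟩ := hV.exists_disjoint_centralizer hcyc hle hc
    exact .inr (exists_hasA4Quotient_of_card_commutator_eq_eight hle hc h h' hx)
  · have hc := hV.le_centralizer_of_isPGroup (IsPGroup.of_card h') hle
    exact absurd hG (hV.commProb_le hcyc hle hc h).not_gt
  · have hc := hV.le_centralizer_of_isPGroup (IsPGroup.of_card h') hle
    exact absurd hG (hV.commProb_le hcyc hle hc h).not_gt

/-- Without a hypothesis on `d(G)`: a group with `|G'| ≤ 5` that is not supersolvable has derived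
subgroup of order four, and the latter is minimal normal, since a smaller normal subgroup `W` would
have order two, and `W` and the derived subgroup of `G / W` would both be cyclic. -/
theorem hasA4Quotient_of_card_commutator_le_five {G : Type*} [Group G] [Finite G]
    (hss : ¬ IsSupersolvable G) (h5 : Nat.card (commutator G) ≤ 5) :
    Nat.card (commutator G) = 4 ∧ HasA4Quotient G := by
  have hcyc : ¬ IsCyclic (commutator G) :=
    fun h ↦ hss (isSupersolvable_of_isCyclic_commutator G h)
  obtain ⟨h1, hp⟩ := not_isCyclic_card hcyc
  have h0 : 0 < Nat.card (commutator G) := Nat.card_pos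
  have h4 : Nat.card (commutator G) = 4 := by
    generalize Nat.card (commutator G) = g at *
    interval_cases g <;> first | omega | exact absurd (by norm_num) hp
  refine ⟨h4, ?_⟩
  obtain ⟨W, hle, hW⟩ := IsMinimalNormal.exists_le (N := commutator G)
    (Subgroup.one_lt_card_iff_ne_bot _ |>.1 (by omega))
  have := hW.normal
  have hWcyc : ¬ IsCyclic W := by
    intro hWc
    have hmul := card_mul_card_commutator_quotient W hle
    have hW1 : 1 < Nat.card W := Subgroup.one_lt_card_iff_ne_bot _ |>.2 hW.ne_bot
    refine hss (.of_quotient W hWc (isSupersolvable_of_isCyclic_commutator _ ?_))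
    by_contra hQ
    obtain ⟨hQ1, hQp⟩ := not_isCyclic_card hQ
    have hQ0 : 0 < Nat.card (commutator (G ⧸ W)) := Nat.card_pos
    have : Nat.card (commutator (G ⧸ W)) ≤ 2 := by nlinarith
    exact hQp (by rw [show Nat.card (commutator (G ⧸ W)) = 2 by omega]; exact Nat.prime_two)
  have hWG : W = commutator G := by
    obtain ⟨hW1, hWp⟩ := not_isCyclic_card hWcyc
    have hd : Nat.card W ∣ 2 ^ 2 := (Subgroup.card_dvd_of_le hle).trans h4.dvd
    obtain ⟨k, hk, hk'⟩ := (Nat.dvd_prime_pow Nat.prime_two).1 hd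
    refine Subgroup.eq_of_le_of_card_ge hle ?_
    interval_cases k
    · exact absurd hk' hW1
    · exact absurd (by rw [hk']; exact Nat.prime_two) hWp
    · omega
  subst hWG
  exact hW.hasA4Quotient hcyc h4

/-! ### Groups with commuting probability above `5/16` -/

theorem theorem1p1 (G : Type*) [Group G] [Finite G] (hG : (5 / 16 : ℚ) < commProb G) :
    IsSupersolvable G ∨
      Isoclinic G (alternatingGroup (Fin 4)) ∨
      Isoclinic (G ⧸ Subgroup.center G) (alternatingGroup (Fin 4)) := by
  by_cases hss : IsSupersolvable G
  · exact .inl hss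
  right
  have h11 := card_commutator_le_of_lt_commProb hG
  have hne : commutator G ≠ ⊥ := fun h ↦
    hss (isSupersolvable_of_isCyclic_commutator G (h ▸ inferInstance))
  obtain ⟨V, hle, hV⟩ := IsMinimalNormal.exists_le hne
  have hVn := hV.normal
  by_cases hcyc : IsCyclic V
  · have hssV : ¬ IsSupersolvable (G ⧸ V) := fun h ↦ hss (.of_quotient V hcyc h)
    have hmul := card_mul_card_commutator_quotient V hle
    have hV1 : 1 < Nat.card V := Subgroup.one_lt_card_iff_ne_bot _ |>.2 hV.ne_bot
    have h5 : Nat.card (commutator (G ⧸ V)) ≤ 5 := by nlinarith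
    obtain ⟨h4, hA4⟩ := hasA4Quotient_of_card_commutator_le_five hssV h5
    rw [h4] at hmul
    have hV2 : Nat.card V = 2 := by omega
    exact .inr (hA4.isoclinic_quotient_center V (Subgroup.le_center_of_card_eq_two hV2))
  · rcases hV.hasA4Quotient_of_lt_commProb hG hle hcyc with h | ⟨M, hM, hMZ, h⟩
    · exact .inl h.isoclinic
    · exact .inr (h.isoclinic_quotient_center M hMZ)
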